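/- Let $D$ be a finite directed graph without loops and without parallel arcs (for two distinct vertices $u,v$ both arcs $(u,v)$ and $(v,u)$ may be present), of even order $n$, and let $p$ be a real number with $\frac12 < p < \frac34$. Suppose that the indegree and the outdegree of every vertex of $D$ are at least $pn$, and that $$n > \frac{\ln 4}{\left(p-\frac12\right)\ln\left(\frac{p+\frac12}{\frac32-p}\right)} - \frac{1}{p-\frac12}.$$ Then $D$ contains an anti-directed 2-factor, that is, a collection of vertex-disjoint anti-directed cycles that together contain all vertices of $D$. Here an anti-directed cycle of $D$ is a cycle in the multigraph obtained from $D$ by ignoring the directions of the arcs, such that no two consecutive arcs of the cycle form a directed path in $D$, i.e. the head of one is never the tail of the other (in particular, two opposite arcs $(u,v),(v,u)$ do not form an anti-directed cycle). -/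

import Mathlib

namespace Digraph

/-- The outdegree of `v`: the number of arcs of `D` directed out of `v`. -/
noncomputable def outDegree {V : Type*} (D : Digraph V) (v : V) : ℕ :=
  {w : V | D.Adj v w}.ncard

/-- The indegree of `v`: the number of arcs of `D` directed into `v`. -/
noncomputable def inDegree {V : Type*} (D : Digraph V) (v : V) : ℕ :=
  {u : V | D.Adj u v}.ncard

/-- A cycle in the multigraph underlying `D` (the multigraph whose edges are the arcs of `D`,
with their directions ignored): cyclically arranged, pairwise distinct vertices `vert i` and
pairwise distinct arcs `arc i = (tail, head)` of `D`, where `arc i` joins `vert i` and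
`vert (i + 1)` in one of the two directions. Two opposite arcs between the same two vertices
are parallel edges, so they form a cycle of length `2` of this multigraph. -/
structure UnderlyingCycle {V : Type*} (D : Digraph V) where
  length : ℕ
  two_le_length : 2 ≤ length
  vert : ZMod length → V
  vert_injective : Function.Injective vert
  arc : ZMod length → V × V
  arc_injective : Function.Injective arc
  arc_adj : ∀ i, D.Adj (arc i).1 (arc i).2
  arc_joins : ∀ i, s((arc i).1, (arc i).2) = s(vert i, vert (i + 1))

/-- The set of vertices of a cycle. -/
def UnderlyingCycle.vertexSet {V : Type*} {D : Digraph V} (C : D.UnderlyingCycle) : Set V :=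
  Set.range C.vert

/-- A cycle is anti-directed if no two consecutive arcs form a directed path, that is, for no two
consecutive arcs is the head of one of them the tail of the other.
In particular a pair of opposite arcs is not an anti-directed cycle. -/
def UnderlyingCycle.IsAntiDirected {V : Type*} {D : Digraph V} (C : D.UnderlyingCycle) : Prop :=
  ∀ i, (C.arc i).2 ≠ (C.arc (i + 1)).1 ∧ (C.arc (i + 1)).2 ≠ (C.arc i).1

/-- An anti-directed 2-factor of `D`: a collection of pairwise vertex-disjoint anti-directed
cycles that together cover all the vertices. -/
def HasAntiDirectedTwoFactor {V : Type*} (D : Digraph V) : Prop :=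
  ∃ F : Set D.UnderlyingCycle,
    (∀ C ∈ F, C.IsAntiDirected) ∧
    F.PairwiseDisjoint UnderlyingCycle.vertexSet ∧
    (⋃ C ∈ F, C.vertexSet) = Set.univ

end Digraph

/-!
Let `2 * m` be the number of vertices. For an `m`-set `X` of vertices consider the bipartite graph
of the arcs from `X` to `Xᶜ`. Every cycle of this graph is anti-directed, so it is enough to find
an `X` for which the graph has a 2-factor, for instance two disjoint perfect matchings `f`, `g`: the
cycles are then traced by the orbits of `g⁻¹ ∘ f` (`Digraph.hasAntiDirectedTwoFactor_of_matchings`).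

By Hall's theorem, applied to the graph and then to the graph without a first perfect matching,
`f` and `g` exist unless, for some `1 ≤ s ≤ (m + 1) / 2`, one side has `s` vertices of degree at
most `s`. Give a vertex of degree `d` the weight `1 / d` if `d ≤ (m + 1) / 2` (and `1` if `d = 0`),
and the weight `0` otherwise. Then such `s` vertices have total weight at least `1`, and one linear
functional detects the failure for all `s` at once (`Digraph.exists_disjoint_matchings`).

Choose `X` at random. A vertex whose relevant degree in `D` is `m + κ` has a hypergeometric degree
in the bipartite graph, and the required bound is that its expected weight is less than
`1 / (2 * m)` (`Digraph.sum_lowDegreeWeight_markedCount_lt`). The weighted terms of the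
hypergeometric distribution grow at least geometrically up to `M = (m + 1) / 2`, so their sum is
controlled by the last one. On the other hand the terms at `M + 1, …, M + κ` exceed the one at `M`
(except that the very last may fall below it), because both binomial coefficients in them
are closer to the middle of their row; one step towards the middle already gains enough. Comparison of the two estimates leaves the
condition `m < κ * (κ + 1)`, which follows from the hypothesis on logarithms through
`log t ≤ t - 1` and `log 4 > 4 / 3` (`Digraph.lt_mul_succ_of_log`).
-/

/-! ### Anti-directed 2-factors from two disjoint matchings -/

namespace Digraph

/-- The closed walk `x, f x, σ x, f (σ x), σ² x, …` that alternates between the two sides of a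
bipartition. -/
def alternatingVert {V : Type*} {P : V → Prop} (f : {x // P x} ≃ {y // ¬ P y})
    (σ : Equiv.Perm {x // P x}) (x : {x // P x}) (k : ℕ) : V :=
  if Even k then (σ^[k / 2] x : V) else (f (σ^[k / 2] x) : V)

/-- The arcs of `alternatingVert`, all of them directed from the side `P` to the other side. -/
def alternatingArc {V : Type*} {P : V → Prop} (f : {x // P x} ≃ {y // ¬ P y})
    (σ : Equiv.Perm {x // P x}) (x : {x // P x}) (k : ℕ) : V × V :=
  ((σ^[(k + 1) / 2] x : V), (f (σ^[k / 2] x) : V))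

section

variable {V : Type*} {P : V → Prop} (f : {x // P x} ≃ {y // ¬ P y})
  (σ : Equiv.Perm {x // P x}) (x : {x // P x})

theorem iterate_add_two_mul_minimalPeriod_div_two (k : ℕ) :
    σ^[(k + 2 * Function.minimalPeriod σ x) / 2] x = σ^[k / 2] x := by
  rw [Nat.add_mul_div_left _ _ two_pos, Function.iterate_add_minimalPeriod_eq]

theorem alternatingVert_periodic :
    Function.Periodic (alternatingVert f σ x) (2 * Function.minimalPeriod σ x) := by
  intro k
  simp [alternatingVert, iterate_add_two_mul_minimalPeriod_div_two, Nat.even_add]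

theorem alternatingArc_joins (k : ℕ) :
    s((alternatingArc f σ x k).1, (alternatingArc f σ x k).2) =
      s(alternatingVert f σ x k, alternatingVert f σ x (k + 1)) := by
  rcases Nat.even_or_odd' k with ⟨j, rfl | rfl⟩
  · have h1 : (2 * j + 1) / 2 = j := by omega
    simp [alternatingArc, alternatingVert, h1]
  · have h1 : (2 * j + 1) / 2 = j := by omega
    have h2 : (2 * j + 1 + 1) / 2 = j + 1 := by omega
    have h3 : Even (2 * j + 1 + 1) := ⟨j + 1, by omega⟩
    simp only [alternatingArc, alternatingVert, h1, h2, if_pos h3,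
      if_neg (Nat.not_even_two_mul_add_one j)]
    exact Sym2.eq_swap

theorem alternatingVert_injOn :
    Set.InjOn (alternatingVert f σ x) (Set.Iio (2 * Function.minimalPeriod σ x)) := by
  intro a ha b hb hab
  simp only [Set.mem_Iio] at ha hb
  have key : σ^[a / 2] x = σ^[b / 2] x → a / 2 = b / 2 := fun h =>
    Function.iterate_injOn_Iio_minimalPeriod (f := σ) (x := x)
      (by simp only [Set.mem_Iio]; omega) (by simp only [Set.mem_Iio]; omega) h
  rcases Nat.even_or_odd a with h1 | h1 <;> rcases Nat.even_or_odd b with h2 | h2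
  · simp only [alternatingVert, if_pos h1, if_pos h2] at hab
    have := key (Subtype.ext hab)
    grind
  · simp only [alternatingVert, if_pos h1, if_neg (Nat.not_even_iff_odd.2 h2)] at hab
    exact absurd (hab ▸ (σ^[a / 2] x).2) (f (σ^[b / 2] x)).2
  · simp only [alternatingVert, if_neg (Nat.not_even_iff_odd.2 h1), if_pos h2] at hab
    exact absurd (hab ▸ (σ^[b / 2] x).2) (f (σ^[a / 2] x)).2
  · simp only [alternatingVert, if_neg (Nat.not_even_iff_odd.2 h1),
      if_neg (Nat.not_even_iff_odd.2 h2)] at hab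
    have := key (f.injective (Subtype.ext hab))
    grind

theorem alternatingArc_injOn (hσ : ∀ y, σ y ≠ y) :
    Set.InjOn (alternatingArc f σ x) (Set.Iio (2 * Function.minimalPeriod σ x)) := by
  intro a ha b hb hab
  simp only [Set.mem_Iio] at ha hb
  simp only [alternatingArc, Prod.mk.injEq] at hab
  have h1 := Subtype.ext hab.1
  have h2 : a / 2 = b / 2 :=
    Function.iterate_injOn_Iio_minimalPeriod (f := σ) (x := x)
      (by simp only [Set.mem_Iio]; omega) (by simp only [Set.mem_Iio]; omega)
      (f.injective (Subtype.ext hab.2))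
  -- two different arcs with the same head have tails `y` and `σ y`
  by_contra hne
  rcases Nat.lt_or_gt_of_ne hne with h | h
  · have h3 : (b + 1) / 2 = (a + 1) / 2 + 1 := by omega
    rw [h3, Function.iterate_succ_apply'] at h1
    exact hσ _ h1.symm
  · have h3 : (a + 1) / 2 = (b + 1) / 2 + 1 := by omega
    rw [h3, Function.iterate_succ_apply'] at h1
    exact hσ _ h1

theorem mem_range_alternatingVert [Finite V] (v : V) :
    (∃ k < 2 * Function.minimalPeriod σ x, alternatingVert f σ x k = v) ↔
      ∃ y, σ.SameCycle x y ∧ (v = y ∨ v = f y) := by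
  constructor
  · rintro ⟨k, -, rfl⟩
    refine ⟨σ^[k / 2] x, ⟨((k / 2 : ℕ) : ℤ), by rw [zpow_natCast, Equiv.Perm.iterate_eq_pow]⟩, ?_⟩
    unfold alternatingVert
    split_ifs <;> simp
  · rintro ⟨y, hy, hv⟩
    obtain ⟨i, rfl⟩ := hy.exists_nat_pow_eq
    have hper : 0 < Function.minimalPeriod σ x :=
      Function.minimalPeriod_pos_of_mem_periodicPts (σ.injective.mem_periodicPts x)
    rw [← Equiv.Perm.iterate_eq_pow, ← Function.iterate_mod_minimalPeriod_eq] at hv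
    have hlt := Nat.mod_lt i hper
    rcases hv with rfl | rfl
    · exact ⟨2 * (i % Function.minimalPeriod σ x), by omega, by simp [alternatingVert]⟩
    · refine ⟨2 * (i % Function.minimalPeriod σ x) + 1, by omega, ?_⟩
      have h1 (j : ℕ) : (2 * j + 1) / 2 = j := by omega
      simp [alternatingVert, h1]

end

/-- The closed walk `alternatingVert` as a cycle: here `σ = g⁻¹ ∘ f` for two matchings `f`, `g`. -/
noncomputable def alternatingCycle {V : Type*} [Finite V] {D : Digraph V} {P : V → Prop}
    (f g : {x // P x} ≃ {y // ¬ P y}) (hf : ∀ x : {x // P x}, D.Adj x (f x))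
    (hg : ∀ x : {x // P x}, D.Adj x (g x))
    (hfg : ∀ x, f x ≠ g x) (x : {x // P x}) : D.UnderlyingCycle :=
  let σ : Equiv.Perm {x // P x} := f.trans g.symm
  have hσ (y) : σ y ≠ y := fun h => hfg y ((Equiv.symm_apply_eq g).1 h)
  have hper : 2 ≤ Function.minimalPeriod σ x := by
    have h0 : 0 < Function.minimalPeriod σ x :=
      Function.minimalPeriod_pos_of_mem_periodicPts (σ.injective.mem_periodicPts x)
    have h1 : Function.minimalPeriod σ x ≠ 1 := fun h =>
      hσ x (Function.minimalPeriod_eq_one_iff_isFixedPt.1 h)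
    omega
  have : NeZero (2 * Function.minimalPeriod σ x) := ⟨by omega⟩
  have : Fact (1 < 2 * Function.minimalPeriod σ x) := ⟨by omega⟩
  { length := 2 * Function.minimalPeriod σ x
    two_le_length := by omega
    vert i := alternatingVert f σ x i.val
    vert_injective i j h := ZMod.val_injective _ <|
      alternatingVert_injOn f σ x (ZMod.val_lt i) (ZMod.val_lt j) h
    arc i := alternatingArc f σ x i.val
    arc_injective i j h := ZMod.val_injective _ <|
      alternatingArc_injOn f σ x hσ (ZMod.val_lt i) (ZMod.val_lt j) h
    arc_adj i := by
      rcases Nat.even_or_odd' i.val with ⟨j, h | h⟩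
      · have h1 : (2 * j + 1) / 2 = j := by omega
        simpa [alternatingArc, h, h1] using hf _
      · have h1 : (2 * j + 1) / 2 = j := by omega
        have h2 : (2 * j + 1 + 1) / 2 = j + 1 := by omega
        have h3 : f (σ^[j] x) = g (σ^[j + 1] x) := by
          rw [Function.iterate_succ_apply']; simp [σ]
        simp only [alternatingArc, h, h1, h2]
        rw [h3]
        exact hg _
    arc_joins i := by
      rw [alternatingArc_joins, ZMod.val_add, ZMod.val_one,
        (alternatingVert_periodic f σ x).map_mod_nat] }

theorem alternatingCycle_vertexSet {V : Type*} [Finite V] {D : Digraph V} {P : V → Prop}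
    (f g : {x // P x} ≃ {y // ¬ P y}) (hf : ∀ x : {x // P x}, D.Adj x (f x))
    (hg : ∀ x : {x // P x}, D.Adj x (g x))
    (hfg : ∀ x, f x ≠ g x) (x : {x // P x}) :
    (alternatingCycle f g hf hg hfg x).vertexSet =
      {v : V | ∃ y : {x // P x}, Equiv.Perm.SameCycle (f.trans g.symm) x y ∧ (v = y ∨ v = f y)} := by
  ext v
  rw [Set.mem_ofPred_eq, ← mem_range_alternatingVert]
  have h0 : 0 < Function.minimalPeriod (f.trans g.symm) x :=
    Function.minimalPeriod_pos_of_mem_periodicPts ((f.trans g.symm).injective.mem_periodicPts x)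
  have : NeZero (2 * Function.minimalPeriod (f.trans g.symm) x) := ⟨by omega⟩
  constructor
  · rintro ⟨i, rfl⟩
    exact ⟨_, ZMod.val_lt (n := 2 * Function.minimalPeriod (f.trans g.symm) x) i, rfl⟩
  · rintro ⟨k, hk, rfl⟩
    refine ⟨(k : ZMod (2 * Function.minimalPeriod (f.trans g.symm) x)), ?_⟩
    exact congrArg (alternatingVert f (f.trans g.symm) x) (ZMod.val_cast_of_lt hk)

theorem alternatingCycle_isAntiDirected {V : Type*} [Finite V] {D : Digraph V} {P : V → Prop}
    (f g : {x // P x} ≃ {y // ¬ P y}) (hf : ∀ x : {x // P x}, D.Adj x (f x))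
    (hg : ∀ x : {x // P x}, D.Adj x (g x))
    (hfg : ∀ x, f x ≠ g x) (x : {x // P x}) :
    (alternatingCycle f g hf hg hfg x).IsAntiDirected := by
  have key (u : {x // P x}) (w : {x // ¬ P x}) : (w : V) ≠ u := fun h => w.2 (h ▸ u.2)
  exact fun i => ⟨key _ _, key _ _⟩

/-- Two disjoint perfect matchings, both directed from `P` to its complement, form an
anti-directed 2-factor. -/
theorem hasAntiDirectedTwoFactor_of_matchings {V : Type*} [Finite V] {D : Digraph V}
    {P : V → Prop} (f g : {x // P x} ≃ {y // ¬ P y}) (hf : ∀ x : {x // P x}, D.Adj x (f x))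
    (hg : ∀ x : {x // P x}, D.Adj x (g x)) (hfg : ∀ x, f x ≠ g x) : D.HasAntiDirectedTwoFactor := by
  let σ : Equiv.Perm {x // P x} := f.trans g.symm
  -- one cycle for each orbit of `σ`, through a chosen representative
  let C (q : Quotient (Equiv.Perm.SameCycle.setoid σ)) : D.UnderlyingCycle :=
    alternatingCycle f g hf hg hfg q.out
  have hC (q v) : v ∈ (C q).vertexSet ↔ ∃ y, σ.SameCycle q.out y ∧ (v = y ∨ v = f y) := by
    simp only [C, alternatingCycle_vertexSet, Set.mem_ofPred_eq, σ]
  have hout (q) (y) : σ.SameCycle (Quotient.out q) y ↔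
      q = Quotient.mk (Equiv.Perm.SameCycle.setoid σ) y := by
    constructor
    · intro h
      rw [← Quotient.out_eq q]
      exact Quotient.sound h
    · rintro rfl
      exact Quotient.mk_out (s := Equiv.Perm.SameCycle.setoid σ) y
  refine ⟨Set.range C, ?_, ?_, ?_⟩
  · rintro _ ⟨q, rfl⟩
    exact alternatingCycle_isAntiDirected f g hf hg hfg _
  · rintro _ ⟨q, rfl⟩ _ ⟨r, rfl⟩ hne
    refine Set.disjoint_left.2 fun v hv hv' => hne ?_
    obtain ⟨y, hy, h1⟩ := (hC q v).1 hv
    obtain ⟨z, hz, h2⟩ := (hC r v).1 hv'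
    have hyz : y = z := by
      rcases h1 with h1 | h1 <;> rcases h2 with h2 | h2
      · exact Subtype.ext (h1.symm.trans h2)
      · exact absurd (h1.symm.trans h2 ▸ y.2) (f z).2
      · exact absurd (h2.symm.trans h1 ▸ z.2) (f y).2
      · exact f.injective (Subtype.ext (h1.symm.trans h2))
    subst hyz
    rw [(hout q y).1 hy, (hout r y).1 hz]
  · refine Set.eq_univ_of_forall fun v => ?_
    simp only [Set.mem_iUnion, Set.mem_range, exists_prop, exists_exists_eq_and]
    by_cases hv : P v
    · exact ⟨_, (hC _ v).2 ⟨⟨v, hv⟩, (hout _ _).2 rfl, Or.inl rfl⟩⟩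
    · exact ⟨_, (hC _ v).2 ⟨f.symm ⟨v, hv⟩, (hout _ _).2 rfl, Or.inr (by simp)⟩⟩

/-! ### Disjoint perfect matchings in bipartite graphs -/

/-- The weight of a vertex of degree `d`, in a bipartite graph with both sides of size `m`: it is
`1 / d` up to `d = ⌊(m + 1) / 2⌋`, with value `1` at `d = 0`, and `0` beyond. -/
noncomputable def lowDegreeWeight (m d : ℕ) : ℝ :=
  if d = 0 then 1 else if d ≤ (m + 1) / 2 then (d : ℝ)⁻¹ else 0

theorem lowDegreeWeight_nonneg (m d : ℕ) : 0 ≤ lowDegreeWeight m d := by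
  unfold lowDegreeWeight; split_ifs <;> positivity

theorem inv_le_lowDegreeWeight {m d s : ℕ} (hd : d ≤ s) (hs : s ≤ (m + 1) / 2) (hs0 : 0 < s) :
    (s : ℝ)⁻¹ ≤ lowDegreeWeight m d := by
  unfold lowDegreeWeight
  split_ifs with h1 h2
  · exact inv_le_one_of_one_le₀ (by exact_mod_cast hs0)
  · have : (0 : ℝ) < d := by exact_mod_cast Nat.pos_of_ne_zero h1
    gcongr
  · omega

/-- `s` vertices of degree at most `s` already have total weight at least `1`. -/
theorem one_le_sum_lowDegreeWeight {ι : Type*} [Fintype ι] {m s : ℕ} (d : ι → ℕ) (S : Finset ι)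
    (hS : ∀ a ∈ S, d a ≤ s) (hcard : s ≤ S.card) (hs : s ≤ (m + 1) / 2) (hs0 : 0 < s) :
    1 ≤ ∑ a, lowDegreeWeight m (d a) := by
  have hpos : (0 : ℝ) < s := by exact_mod_cast hs0
  calc (1 : ℝ) = s * (s : ℝ)⁻¹ := (mul_inv_cancel₀ hpos.ne').symm
    _ ≤ S.card * (s : ℝ)⁻¹ := by gcongr
    _ = ∑ a ∈ S, (s : ℝ)⁻¹ := by simp
    _ ≤ ∑ a ∈ S, lowDegreeWeight m (d a) :=
        Finset.sum_le_sum fun a ha => inv_le_lowDegreeWeight (hS a ha) hs hs0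
    _ ≤ ∑ a, lowDegreeWeight m (d a) :=
        Finset.sum_le_sum_of_subset_of_nonneg (Finset.subset_univ _)
          fun _ _ _ => lowDegreeWeight_nonneg _ _

open Classical in
/-- A bipartite graph `R` whose degrees are at least `dα - 1` and `dβ - 1` has a perfect matching
if the total weight of `dα` and `dβ` is less than `1`. If Hall's condition fails for `s` vertices
on one side, then these have small degree, and so have at least `m - s + 1` vertices of the other
side; one of the two sets is small enough for its vertices to carry total weight `1`. -/
theorem exists_equiv_of_sum_lowDegreeWeight_lt_one {α β : Type*} [Fintype α] [Fintype β] {m : ℕ}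
    (hα : Fintype.card α = m) (hβ : Fintype.card β = m) (R : α → β → Prop) (dα : α → ℕ)
    (dβ : β → ℕ) (hdα : ∀ a, dα a ≤ (Finset.univ.filter (R a)).card + 1)
    (hdβ : ∀ b, dβ b ≤ (Finset.univ.filter (R · b)).card + 1)
    (hw : ∑ a, lowDegreeWeight m (dα a) + ∑ b, lowDegreeWeight m (dβ b) < 1) :
    ∃ f : α ≃ β, ∀ a, R a (f a) := by
  have hall : ∀ S : Finset α,
      S.card ≤ (S.biUnion fun a => Finset.univ.filter (R a)).card := by
    intro S
    by_contra! hS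
    set N := S.biUnion fun a => Finset.univ.filter (R a) with hN
    have hSm : S.card ≤ m := hα ▸ S.card_le_univ
    have hS1 : ∀ a ∈ S, dα a ≤ S.card := fun a ha => by
      have : (Finset.univ.filter (R a)).card ≤ N.card :=
        Finset.card_le_card (Finset.subset_biUnion_of_mem (fun a => Finset.univ.filter (R a)) ha)
      have := hdα a
      omega
    have hT1 : ∀ b ∈ Nᶜ, dβ b ≤ m - S.card + 1 := fun b hb => by
      have hsub : Finset.univ.filter (R · b) ⊆ Sᶜ := fun a ha => by
        simp only [Finset.mem_filter, Finset.mem_univ, true_and, Finset.mem_compl] at ha ⊢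
        exact fun haS => Finset.mem_compl.1 hb (Finset.mem_biUnion.2 ⟨a, haS, by simpa using ha⟩)
      have h1 := Finset.card_le_card hsub
      rw [Finset.card_compl, hα] at h1
      have := hdβ b
      omega
    have hT2 : m - S.card + 1 ≤ Nᶜ.card := by
      rw [Finset.card_compl, hβ]; omega
    have h0α : 0 ≤ ∑ a, lowDegreeWeight m (dα a) :=
      Finset.sum_nonneg fun _ _ => lowDegreeWeight_nonneg _ _
    have h0β : 0 ≤ ∑ b, lowDegreeWeight m (dβ b) :=
      Finset.sum_nonneg fun _ _ => lowDegreeWeight_nonneg _ _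
    rcases le_or_gt S.card ((m + 1) / 2) with hs | hs
    · have := one_le_sum_lowDegreeWeight dα S hS1 le_rfl hs (by omega)
      linarith
    · have := one_le_sum_lowDegreeWeight (m := m) dβ Nᶜ hT1 hT2 (by omega) (by omega)
      linarith
  obtain ⟨f, hf, hfR⟩ := (Finset.all_card_le_biUnion_card_iff_exists_injective _).1 hall
  refine ⟨Equiv.ofBijective f ((Fintype.bijective_iff_injective_and_card f).2
    ⟨hf, hα.trans hβ.symm⟩), fun a => ?_⟩
  simpa using hfR a

open Classical in
/-- A balanced bipartite graph of total weight less than `1` has two disjoint perfect matchings: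
the removal of the first one lowers each degree by `1`. -/
theorem exists_disjoint_matchings {α β : Type*} [Fintype α] [Fintype β] {m : ℕ}
    (hα : Fintype.card α = m) (hβ : Fintype.card β = m) (R : α → β → Prop)
    (hw : ∑ a, lowDegreeWeight m (Finset.univ.filter (R a)).card +
      ∑ b, lowDegreeWeight m (Finset.univ.filter (R · b)).card < 1) :
    ∃ f g : α ≃ β, (∀ a, R a (f a)) ∧ (∀ a, R a (g a)) ∧ ∀ a, f a ≠ g a := by
  obtain ⟨f, hf⟩ := exists_equiv_of_sum_lowDegreeWeight_lt_one hα hβ R _ _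
    (fun a => Nat.le_succ _) (fun b => Nat.le_succ _) hw
  have hα' (a : α) : (Finset.univ.filter (R a)).card ≤
      (Finset.univ.filter fun b => R a b ∧ f a ≠ b).card + 1 := by
    rw [← Finset.card_erase_add_one (s := Finset.univ.filter (R a)) (a := f a) (by simp [hf])]
    gcongr
    intro b
    simp +contextual [eq_comm]
  have hβ' (b : β) : (Finset.univ.filter (R · b)).card ≤
      (Finset.univ.filter fun a => R a b ∧ f a ≠ b).card + 1 := by
    rw [← Finset.card_erase_add_one (s := Finset.univ.filter (R · b)) (a := f.symm b)
      (by simpa using hf (f.symm b))]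
    gcongr
    intro a
    simp +contextual [Equiv.eq_symm_apply]
  obtain ⟨g, hg⟩ := exists_equiv_of_sum_lowDegreeWeight_lt_one hα hβ
    (fun a b => R a b ∧ f a ≠ b) _ _
    (fun a => by convert hα' a) (fun b => by convert hβ' b) hw
  exact ⟨f, g, hf, fun a => (hg a).1, fun a => (hg a).2⟩

end Digraph

/-! ### The lower tail of the hypergeometric distribution -/

theorem Nat.choose_le_choose_of_add_le {n k j : ℕ} (hkj : k ≤ j) (hn : j + k ≤ n) :
    n.choose k ≤ n.choose j := by
  have mono : ∀ i, k ≤ i → 2 * i ≤ n → n.choose k ≤ n.choose i := by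
    intro i hi
    induction i, hi using Nat.le_induction with
    | base => exact fun _ => le_rfl
    | succ i hi ih =>
      exact fun h => (ih (by omega)).trans (Nat.choose_le_succ_of_lt_half_left (by omega))
  rcases le_or_gt (2 * j) n with h | h
  · exact mono j hkj h
  · rw [← Nat.choose_symm (show j ≤ n by omega)]
    exact mono (n - j) (by omega) (by omega)

namespace Digraph

/-- The number of `m`-subsets of a `(2m - 1)`-set that contain exactly `d` of `m + κ` marked
elements. -/
def markedCount (m κ d : ℕ) : ℕ := (m + κ).choose d * (m - 1 - κ).choose (m - d)

theorem markedCount_eq_zero {m κ d : ℕ} (hm : κ + 1 ≤ m) (hd : d ≤ κ) :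
    markedCount m κ d = 0 := by
  rw [markedCount, Nat.choose_eq_zero_of_lt (show m - 1 - κ < m - d by omega), mul_zero]

theorem markedCount_pos {m κ d : ℕ} (hd : κ < d) (hdm : d ≤ m) :
    0 < markedCount m κ d :=
  Nat.mul_pos (Nat.choose_pos (by omega)) (Nat.choose_pos (by omega))

theorem markedCount_succ {m κ d : ℕ} (hd : κ ≤ d) (hdm : d < m) :
    markedCount m κ (d + 1) * ((d + 1) * (d - κ)) =
      markedCount m κ d * ((m + κ - d) * (m - d)) := by
  have h1 := Nat.choose_succ_right_eq (m + κ) d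
  have h2 := Nat.choose_succ_right_eq (m - 1 - κ) (m - d - 1)
  have e1 : m - d - 1 + 1 = m - d := by omega
  have e2 : m - 1 - κ - (m - d - 1) = d - κ := by omega
  rw [e1, e2] at h2
  have e3 : m - (d + 1) = m - d - 1 := by omega
  unfold markedCount
  rw [e3]
  calc (m + κ).choose (d + 1) * (m - 1 - κ).choose (m - d - 1) * ((d + 1) * (d - κ))
      = ((m + κ).choose (d + 1) * (d + 1)) * ((m - 1 - κ).choose (m - d - 1) * (d - κ)) := by ring
    _ = _ := by rw [h1, ← h2]; ring

theorem sum_markedCount {m κ : ℕ} (hm : κ + 1 ≤ m) :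
    ∑ d ∈ Finset.range (m + 1), markedCount m κ d = (2 * m - 1).choose m := by
  have e : 2 * m - 1 = (m + κ) + (m - 1 - κ) := by omega
  rw [e, Nat.add_choose_eq, Finset.Nat.sum_antidiagonal_eq_sum_range_succ_mk]
  rfl

theorem sum_markedCount_window_le {m κ M k : ℕ} (hm : κ + 1 ≤ m) (hk : M + k ≤ m) :
    ∑ i ∈ Finset.range (k + 1), markedCount m κ (M + i) ≤ (2 * m - 1).choose m := by
  rw [← sum_markedCount hm, ← Finset.sum_image (s := Finset.range (k + 1)) (g := fun i => M + i)
    (f := markedCount m κ) (by intro a _ b _ h; simpa using h)]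
  refine Finset.sum_le_sum_of_subset fun d hd => ?_
  simp only [Finset.mem_image, Finset.mem_range] at hd ⊢
  omega

/-- The terms `markedCount m κ d / d` grow at least geometrically up to `d = M`. -/
theorem markedCount_div_le {m κ M d : ℕ} (hM : M < m) (hd : κ < d) (hdM : d + 1 ≤ M) :
    (markedCount m κ d : ℝ) / d ≤
      (M ^ 2 * (M - 1 - κ)) / ((M - 1) * (m - M + κ + 1) * (m - M + 1)) *
        (markedCount m κ (d + 1) / (d + 1 : ℕ)) := by
  have hrec : (markedCount m κ (d + 1) : ℝ) * ((d + 1) * (d - κ)) =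
      markedCount m κ d * ((m + κ - d) * (m - d)) := by
    have := markedCount_succ (m := m) (κ := κ) (d := d) hd.le (by omega)
    rw [← Nat.cast_inj (R := ℝ)] at this
    push_cast [Nat.cast_sub hd.le, Nat.cast_sub (show d ≤ m by omega),
      Nat.cast_sub (show d ≤ m + κ by omega)] at this
    exact this
  have hd' : (κ : ℝ) + 1 ≤ d := by exact_mod_cast hd
  have hκ : (0 : ℝ) ≤ κ := κ.cast_nonneg
  have hdM' : (d : ℝ) + 1 ≤ M := by exact_mod_cast hdM
  have hMm : (M : ℝ) + 1 ≤ m := by exact_mod_cast hM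
  set a := (markedCount m κ d : ℝ) with ha
  set b := (markedCount m κ (d + 1) : ℝ) with hb
  have ha0 : 0 ≤ a := Nat.cast_nonneg _
  have hpos : (0 : ℝ) < (d + 1) * (d - κ) := mul_pos (by linarith) (by linarith)
  have hb' : b = a * ((m + κ - d) * (m - d)) / ((d + 1) * (d - κ)) := by
    rw [eq_div_iff hpos.ne', hrec]
  have hQ : (0 : ℝ) < (M - 1) * (m - M + κ + 1) * (m - M + 1) :=
    mul_pos (mul_pos (by linarith) (by linarith)) (by linarith)
  have key : ((d : ℝ) + 1) ^ 2 * (d - κ) * ((M - 1) * (m - M + κ + 1) * (m - M + 1)) ≤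
      M ^ 2 * (M - 1 - κ) * (d * (m + κ - d) * (m - d)) := by
    have h1 : (d - κ : ℝ) * (M - 1) ≤ (M - 1 - κ) * d := by nlinarith
    have h2 : ((d : ℝ) + 1) ^ 2 ≤ M ^ 2 := by gcongr
    have h3 : (m - M + κ + 1 : ℝ) * (m - M + 1) ≤ (m + κ - d) * (m - d) :=
      mul_le_mul (by linarith) (by linarith) (by linarith) (by linarith)
    calc ((d : ℝ) + 1) ^ 2 * (d - κ) * ((M - 1) * (m - M + κ + 1) * (m - M + 1))
        = ((d : ℝ) + 1) ^ 2 * ((d - κ) * (M - 1)) * ((m - M + κ + 1) * (m - M + 1)) := by ring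
      _ ≤ (M : ℝ) ^ 2 * ((M - 1 - κ) * d) * ((m + κ - d) * (m - d)) := by
          have : (0 : ℝ) ≤ (d - κ) * (M - 1) := mul_nonneg (by linarith) (by linarith)
          have : (0 : ℝ) ≤ (m - M + κ + 1) * (m - M + 1) :=
            mul_nonneg (by linarith) (by linarith)
          have : (0 : ℝ) ≤ (M - 1 - κ) * d := mul_nonneg (by linarith) (by linarith)
          gcongr
      _ = _ := by ring
  have hd0 : (0 : ℝ) < d := by linarith
  have hden : (0 : ℝ) < (d + 1) ^ 2 * (d - κ) * ((M - 1) * (m - M + κ + 1) * (m - M + 1)) :=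
    mul_pos (mul_pos (by positivity) (by linarith)) hQ
  have hsub : (d - κ : ℝ) ≠ 0 := by linarith
  rw [div_le_iff₀ hd0]
  calc a = a * 1 := (mul_one a).symm
    _ ≤ a * (M ^ 2 * (M - 1 - κ) * (d * (m + κ - d) * (m - d)) /
        ((d + 1) ^ 2 * (d - κ) * ((M - 1) * (m - M + κ + 1) * (m - M + 1)))) := by
      gcongr
      exact (one_le_div hden).2 key
    _ = _ := by
      rw [hb', Nat.cast_add, Nat.cast_one]
      generalize (M - 1 : ℝ) * (m - M + κ + 1) * (m - M + 1) = Q at hQ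
      have := hQ.ne'
      field_simp

/-- Summing the geometric growth: all terms up to `M` together are controlled by the last one. -/
theorem sum_lowDegreeWeight_markedCount_le {m κ M : ℕ} (hMeq : M = (m + 1) / 2)
    (hκM : κ < M) (hM : M < m) {q : ℝ}
    (hq : q = (M ^ 2 * (M - 1 - κ)) / ((M - 1) * (m - M + κ + 1) * (m - M + 1))) :
    (1 - q) * ∑ d ∈ Finset.range (m + 1), lowDegreeWeight m d * markedCount m κ d ≤
      markedCount m κ M / M := by
  have hq0 : 0 ≤ q := by
    have h1 : (κ : ℝ) + 1 ≤ M := by exact_mod_cast hκM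
    have h2 : (M : ℝ) + 1 ≤ m := by exact_mod_cast hM
    have h3 : (0 : ℝ) ≤ κ := κ.cast_nonneg
    rw [hq]
    exact div_nonneg (mul_nonneg (by positivity) (by linarith))
      (mul_nonneg (mul_nonneg (by linarith) (by linarith)) (by linarith))
  have hw {d : ℕ} (hd : κ < d) (hdM : d ≤ M) :
      lowDegreeWeight m d * markedCount m κ d = (markedCount m κ d : ℝ) / d := by
    rw [lowDegreeWeight, if_neg (by omega), if_pos (by omega), inv_mul_eq_div]
  have hzero : ∑ d ∈ Finset.range (κ + 1), lowDegreeWeight m d * markedCount m κ d = 0 :=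
    Finset.sum_eq_zero fun d hd => by
      rw [markedCount_eq_zero (by omega) (by simpa [Nat.lt_succ_iff] using hd), Nat.cast_zero,
        mul_zero]
  have hind : ∀ D, κ + 1 ≤ D → D ≤ M →
      (1 - q) * ∑ d ∈ Finset.range (D + 1), lowDegreeWeight m d * markedCount m κ d ≤
        markedCount m κ D / D := by
    intro D hD
    induction D, hD using Nat.le_induction with
    | base =>
      intro h
      rw [Finset.sum_range_succ, hzero, zero_add, hw (Nat.lt_succ_self κ) h]
      exact mul_le_of_le_one_left (by positivity) (by linarith)
    | succ D hD ih =>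
      intro h
      rw [Finset.sum_range_succ, hw (show κ < D + 1 by omega) h, mul_add]
      have h1 := ih (by omega)
      have h2 := markedCount_div_le (κ := κ) hM hD h
      rw [← hq] at h2
      linarith
  have htrunc : ∑ d ∈ Finset.range (m + 1), lowDegreeWeight m d * (markedCount m κ d : ℝ) =
      ∑ d ∈ Finset.range (M + 1), lowDegreeWeight m d * markedCount m κ d := by
    symm
    refine Finset.sum_subset (Finset.range_subset_range.2 (by omega)) fun d _ hd => ?_
    rw [Finset.mem_range] at hd
    rw [lowDegreeWeight, if_neg (by omega), if_neg (by omega), zero_mul]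
  rw [htrunc]
  exact hind M hκM le_rfl

theorem cast_choose_succ (n k : ℕ) (hk : k ≤ n) :
    (n.choose (k + 1) : ℝ) = (n - k) / (k + 1) * n.choose k := by
  have h := Nat.choose_succ_right_eq n k
  rw [← Nat.cast_inj (R := ℝ)] at h
  push_cast [Nat.cast_sub hk] at h
  field_simp
  linarith

/-- For `m = 2 h`, the terms from `d = h` to `d = h + κ` have sum at least `κ + 3` times the first
one. -/
theorem le_choose_of_even {h κ : ℕ} (hκ : 1 ≤ κ) (hκh : κ < h) (hh : 2 * h ≤ κ * (κ + 2)) :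
    (κ + 3 : ℝ) * markedCount (2 * h) κ h ≤ (2 * (2 * h) - 1).choose (2 * h) := by
  -- the entry at `h` mirrors the one at `h - 1 - κ`, and moving one step inwards from there gains
  -- the factor `h / (h - κ)`
  have hB : (κ + 2 : ℝ) * (2 * h - 1 - κ).choose h ≤ κ * (2 * h - 1 - κ).choose (h - κ) := by
    have h1 := cast_choose_succ (2 * h - 1 - κ) (h - 1 - κ) (by omega)
    rw [show h - 1 - κ + 1 = h - κ by omega] at h1
    rw [h1, ← Nat.choose_symm (n := 2 * h - 1 - κ) (k := h) (by omega),
      show 2 * h - 1 - κ - h = h - 1 - κ by omega, ← mul_assoc]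
    gcongr
    have e1 : ((2 * h - 1 - κ : ℕ) : ℝ) = 2 * h - 1 - κ := by
      rw [Nat.cast_sub (by omega), Nat.cast_sub (by omega)]; push_cast; ring
    have e2 : ((h - 1 - κ : ℕ) : ℝ) = h - 1 - κ := by
      rw [Nat.cast_sub (by omega), Nat.cast_sub (by omega)]; push_cast; ring
    have h3 : (κ : ℝ) + 1 ≤ h := by exact_mod_cast hκh
    have h4 : (2 * h : ℝ) ≤ κ * (κ + 2) := by exact_mod_cast hh
    rw [e1, e2, mul_div_assoc', le_div_iff₀ (by linarith)]
    nlinarith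
  have hterm : ∀ i ∈ Finset.range κ,
      (2 * h + κ).choose h * ((2 * h - 1 - κ).choose (h - κ) : ℝ) ≤
        markedCount (2 * h) κ (h + (i + 1)) := by
    intro i hi
    rw [Finset.mem_range] at hi
    rw [markedCount, Nat.cast_mul]
    gcongr ?_ * ?_
    · exact_mod_cast Nat.choose_le_choose_of_add_le (by omega) (by omega)
    · exact_mod_cast Nat.choose_le_choose_of_add_le (by omega) (by omega)
  have hsum := sum_markedCount_window_le (m := 2 * h) (κ := κ) (M := h) (k := κ)
    (by omega) (by omega)
  rw [← Nat.cast_le (α := ℝ), Nat.cast_sum, Finset.sum_range_succ'] at hsum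
  have hlow := Finset.card_nsmul_le_sum _ _ _ hterm
  rw [Finset.card_range, nsmul_eq_mul] at hlow
  have e : (markedCount (2 * h) κ h : ℝ) = (2 * h + κ).choose h * (2 * h - 1 - κ).choose h := by
    rw [markedCount, Nat.cast_mul, show 2 * h - h = h by omega]
  have h5 := mul_le_mul_of_nonneg_left hB ((2 * h + κ).choose h).cast_nonneg (α := ℝ)
  rw [add_zero] at hsum
  rw [e] at hsum ⊢
  nlinarith

/-- For `m = 2 h + 1`, a lower bound for the sum of the terms from `d = h + 1` to `d = h + 1 + κ`,
relative to the first one. Interior terms gain the factors `(h + κ) / (h + 2)` and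
`h / (h + 1 - κ)`, the ratios of consecutive entries at the ends of the two symmetric windows in
the rows of Pascal's triangle. -/
theorem le_choose_of_odd {h κ : ℕ} (hκ : 2 ≤ κ) (hκh : κ ≤ h) :
    (1 + (κ - 2) * ((h + κ) / (h + 2)) * (h / (h + 1 - κ)) + h / (h + 1 - κ) +
      (h + 1) / (h + κ + 1) : ℝ) * markedCount (2 * h + 1) κ (h + 1) ≤
      (2 * (2 * h + 1) - 1).choose (2 * h + 1) := by
  obtain ⟨c, rfl⟩ := Nat.exists_eq_add_of_le' hκ
  obtain ⟨e, rfl⟩ := Nat.exists_eq_add_of_le' hκh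
  set h := e + (c + 2) with hh
  set x := ((2 * h + 1 + (c + 2)).choose (h + 1) : ℝ) with hx
  set y := ((2 * h + 1 - 1 - (c + 2)).choose h : ℝ) with hy
  have hhr : (h : ℝ) = e + c + 2 := by rw [hh]; push_cast; ring
  have hl : 2 * h + 1 - 1 - (c + 2) = h + e := by omega
  have hx1 : ((2 * h + 1 + (c + 2)).choose (h + 2) : ℝ) = (h + (c + 2)) / (h + 2) * x := by
    rw [cast_choose_succ _ _ (by omega)]
    congr 1; push_cast; congr 1 <;> ring
  have hx2 : ((2 * h + 1 + (c + 2)).choose (h + 1 + (c + 2)) : ℝ) =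
      (h + 1) / (h + (c + 2) + 1) * x := by
    rw [hx, cast_choose_succ _ h (by omega),
      ← Nat.choose_symm (n := 2 * h + 1 + (c + 2)) (k := h) (by omega),
      show 2 * h + 1 + (c + 2) - h = h + 1 + (c + 2) by omega]
    have : (2 * h + 1 + (c + 2) - h : ℝ) ≠ 0 := by nlinarith [h.cast_nonneg (α := ℝ)]
    push_cast
    field_simp
    ring
  have hy0 : ((h + e).choose e : ℝ) = y := by
    rw [hy, hl, ← Nat.choose_symm (n := h + e) (k := h) (by omega), Nat.add_sub_cancel_left]
  have hy1 : ((h + e).choose (e + 1) : ℝ) = h / (h + 1 - (c + 2)) * y := by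
    rw [cast_choose_succ _ _ (by omega), hy0]
    congr 1; push_cast; congr 1
    · ring
    · rw [hhr]; ring
  have hterm : ∀ i ∈ Finset.range c,
      ((h + (c + 2)) / (h + 2) * x) * (h / (h + 1 - (c + 2)) * y) ≤
        markedCount (2 * h + 1) (c + 2) (h + 1 + (i + 1)) := by
    intro i hi
    rw [Finset.mem_range] at hi
    rw [markedCount, Nat.cast_mul, ← hx1, ← hy1, hl]
    gcongr ?_ * ?_
    · exact_mod_cast Nat.choose_le_choose_of_add_le (by omega) (by omega)
    · exact_mod_cast Nat.choose_le_choose_of_add_le (by omega) (by omega)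
  have hlast : x * (h / (h + 1 - (c + 2)) * y) ≤
      markedCount (2 * h + 1) (c + 2) (h + 1 + (c + 1)) := by
    rw [markedCount, Nat.cast_mul, ← hy1, hl]
    gcongr ?_ * ?_
    · exact_mod_cast Nat.choose_le_choose_of_add_le (by omega) (by omega)
    · exact_mod_cast Nat.choose_le_choose_of_add_le (by omega) (by omega)
  have hend : (h + 1) / (h + (c + 2) + 1) * x * y =
      markedCount (2 * h + 1) (c + 2) (h + 1 + (c + 2)) := by
    rw [markedCount, Nat.cast_mul, ← hx2, ← hy0, hl,
      show 2 * h + 1 - (h + 1 + (c + 2)) = e by omega]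
  have hzero : (markedCount (2 * h + 1) (c + 2) (h + 1) : ℝ) = x * y := by
    rw [markedCount, Nat.cast_mul, show 2 * h + 1 - (h + 1) = h by omega]
  have hsum := sum_markedCount_window_le (m := 2 * h + 1) (κ := c + 2) (M := h + 1) (k := c + 2)
    (by omega) (by omega)
  rw [← Nat.cast_le (α := ℝ), Nat.cast_sum, Finset.sum_range_succ, Finset.sum_range_succ,
    Finset.sum_range_succ', add_zero, hzero, ← hend] at hsum
  have hlow := Finset.card_nsmul_le_sum _ _ _ hterm
  rw [Finset.card_range, nsmul_eq_mul] at hlow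
  rw [hzero]
  push_cast
  refine le_trans (le_of_eq ?_) ((add_le_add_left (add_le_add (add_le_add hlow le_rfl) hlast)
    _).trans hsum)
  ring

/-- The expected weight of a vertex is less than `1 / (2 m)`: here `κ` is the excess over `m` of its
degree, and the hypothesis on `m` says that `κ` is at least of the order of the standard
deviation. -/
theorem sum_lowDegreeWeight_markedCount_lt {m κ : ℕ} (hκ : 1 ≤ κ) (hκm : κ + 1 ≤ m)
    (hm : m < κ * (κ + 1)) :
    (2 * m) * ∑ d ∈ Finset.range (m + 1), lowDegreeWeight m d * markedCount m κ d <
      ((2 * m - 1).choose m : ℝ) := by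
  rcases le_or_gt ((m + 1) / 2) κ with hM | hM
  -- degrees up to `κ` do not occur, and those beyond `(m + 1) / 2` have weight `0`
  · rw [Finset.sum_eq_zero, mul_zero]
    · exact_mod_cast Nat.choose_pos (by omega)
    · intro d _
      rcases le_or_gt d κ with h | h
      · rw [markedCount_eq_zero hκm h, Nat.cast_zero, mul_zero]
      · rw [lowDegreeWeight, if_neg (by omega), if_neg (by omega), zero_mul]
  have hκ1 : (1 : ℝ) ≤ κ := by exact_mod_cast hκ
  have hsum := sum_lowDegreeWeight_markedCount_le rfl hM (by omega) rfl
  set S := ∑ d ∈ Finset.range (m + 1), lowDegreeWeight m d * (markedCount m κ d : ℝ)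
  rcases Nat.even_or_odd' m with ⟨h, rfl | rfl⟩
  · have hM2 : (2 * h + 1) / 2 = h := by omega
    rw [hM2] at hM hsum
    -- both sides of `2 * h < κ * (κ + 1)` are even
    have hh : 2 * h + 2 ≤ κ * (κ + 1) := by
      have := Nat.even_mul_succ_self κ
      grind
    have htot := le_choose_of_even hκ hM (by nlinarith)
    have ha : (0 : ℝ) < markedCount (2 * h) κ h := by
      exact_mod_cast markedCount_pos hM (by omega)
    set a := (markedCount (2 * h) κ h : ℝ)
    have hhκ : (κ : ℝ) + 1 ≤ h := by exact_mod_cast hM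
    have hh' : (2 * h + 2 : ℝ) ≤ κ * (κ + 1) := by exact_mod_cast hh
    have hh0 : (0 : ℝ) < h := by linarith
    have hh1 : (0 : ℝ) < h ^ 2 - 1 := by nlinarith
    set q : ℝ := h ^ 2 * (h - 1 - κ) / ((h - 1) * ((2 * h : ℕ) - h + κ + 1) * ((2 * h : ℕ) - h + 1))
      with hq
    have hq' : 1 - q = ((κ + 1) * (2 * h ^ 2 - 1) - h) / ((h ^ 2 - 1) * (h + κ + 1)) := by
      have : (h : ℝ) - 1 ≠ 0 := by linarith
      have e : ((h - 1) * ((2 * h : ℕ) - h + κ + 1) * ((2 * h : ℕ) - h + 1) : ℝ) =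
          (h ^ 2 - 1) * (h + κ + 1) := by push_cast; ring
      rw [hq, e, eq_div_iff (by positivity), sub_mul, div_mul_cancel₀ _ (by positivity)]
      ring
    have key : 4 < (κ + 3) * (1 - q) := by
      rw [hq', mul_div_assoc', lt_div_iff₀ (by positivity)]
      nlinarith [mul_le_mul_of_nonneg_left hh' (sq_nonneg (h : ℝ)),
        mul_pos (show (0 : ℝ) < κ + 3 by linarith)
          (show (0 : ℝ) < 2 * h ^ 2 - h - κ - 1 by nlinarith)]
    have hq0 : 0 < 1 - q := by nlinarith
    rw [le_div_iff₀ hh0] at hsum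
    push_cast
    have h1 : 2 * (2 * h) * S * (1 - q) ≤ 4 * a := by linarith
    have h2 : 4 * a < (κ + 3) * a * (1 - q) := by linarith [mul_lt_mul_of_pos_right key ha]
    have h3 := mul_le_mul_of_nonneg_right htot hq0.le
    exact lt_of_mul_lt_mul_right ((h1.trans_lt h2).trans_le h3) hq0.le
  · have hM2 : (2 * h + 1 + 1) / 2 = h + 1 := by omega
    rw [hM2] at hM hsum
    have hh : 2 * h + 2 ≤ κ * (κ + 1) := by omega
    have hκ2 : 2 ≤ κ := by
      by_contra hlt
      obtain rfl : κ = 1 := by omega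
      omega
    have htot := le_choose_of_odd hκ2 (by omega : κ ≤ h)
    have ha : (0 : ℝ) < markedCount (2 * h + 1) κ (h + 1) := by
      exact_mod_cast markedCount_pos hM (by omega)
    set a := (markedCount (2 * h + 1) κ (h + 1) : ℝ)
    have hhκ : (κ : ℝ) ≤ h := by exact_mod_cast Nat.lt_succ_iff.1 hM
    have hh' : (2 * h + 2 : ℝ) ≤ κ * (κ + 1) := by exact_mod_cast hh
    have hκ2' : (2 : ℝ) ≤ κ := by exact_mod_cast hκ2
    have hh0 : (0 : ℝ) < h := by linarith
    set q : ℝ := ((h + 1 : ℕ) : ℝ) ^ 2 * ((h + 1 : ℕ) - 1 - κ) /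
      (((h + 1 : ℕ) - 1) * ((2 * h + 1 : ℕ) - (h + 1 : ℕ) + κ + 1) *
        ((2 * h + 1 : ℕ) - (h + 1 : ℕ) + 1)) with hq
    have hq' : 1 - q = κ * (2 * h + 1) / (h * (h + κ + 1)) := by
      have e : (((h + 1 : ℕ) - 1) * ((2 * h + 1 : ℕ) - (h + 1 : ℕ) + κ + 1) *
        ((2 * h + 1 : ℕ) - (h + 1 : ℕ) + 1) : ℝ) = h * (h + κ + 1) * (h + 1) := by
          push_cast; ring
      rw [hq, e]
      push_cast
      field_simp
      ring
    set B : ℝ := h / (h + 1 - κ) with hB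
    have hB1 : 1 + 2 / κ ≤ B := by
      rw [hB, le_div_iff₀ (by linarith)]
      field_simp
      nlinarith
    set A : ℝ := (h + κ) / (h + 2) with hA
    have hA1 : A = 1 + (κ - 2) / (h + 2) := by
      rw [hA]; field_simp; ring
    have key : 2 * h / κ + 2 * h / (h + 1) <
        1 + (κ - 2) * A * B + B + (h + 1) / (h + κ + 1) := by
      have hAB : A * (1 + 2 / κ) ≤ A * B := by gcongr
      have h1 : 2 * h / κ ≤ κ + 1 - 2 / (κ : ℝ) := by
        rw [div_le_iff₀ (by linarith)]
        field_simp
        nlinarith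
      have h2 : 2 * h / (h + 1) = 2 - 2 / (h + 1 : ℝ) := by field_simp; ring
      have h3 : (h + 1) / (h + κ + 1) = 1 - κ / (h + κ + 1 : ℝ) := by field_simp; ring
      have h4 : κ / (h + κ + 1 : ℝ) < 2 / (h + 1) + (κ - 2) ^ 2 * (κ + 2) / (κ * (h + 2)) := by
        have h8 : (κ - 2 : ℝ) ≤ (κ - 2) ^ 2 * (κ + 2) / κ := by
          rw [le_div_iff₀ (by linarith)]
          rcases hκ2.eq_or_lt with rfl | h9
          · norm_num
          · have h9' : (3 : ℝ) ≤ κ := by exact_mod_cast h9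
            nlinarith [mul_nonneg (sub_nonneg.2 hκ2') (show (0 : ℝ) ≤ κ ^ 2 - κ - 4 by nlinarith)]
        calc κ / (h + κ + 1 : ℝ) < κ / (h + 2) :=
            div_lt_div_of_pos_left (by linarith) (by linarith) (by linarith)
          _ = 2 / (h + 2) + (κ - 2) / (h + 2) := by ring
          _ ≤ 2 / (h + 1) + (κ - 2) ^ 2 * (κ + 2) / κ / (h + 2) := by gcongr; norm_num
          _ = _ := by rw [div_div]
      have h5 : (κ - 2) * (A * (1 + 2 / κ)) =
        κ - 4 / κ + (κ - 2) ^ 2 * (κ + 2) / (κ * (h + 2)) := by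
        rw [hA1]; field_simp; ring
      have h6 : (κ - 2) * (A * (1 + 2 / κ)) ≤ (κ - 2) * (A * B) := by
        gcongr
      have h7 : 4 / (κ : ℝ) = 2 * (2 / κ) := by ring
      rw [h2, h3]
      linarith
    have hq0 : 0 < 1 - q := by rw [hq']; positivity
    push_cast at hsum ⊢
    rw [le_div_iff₀ (by positivity)] at hsum
    have e2 : (2 * h / κ + 2 * h / (h + 1)) * (1 - q) * (h + 1) = 2 * (2 * h + 1) := by
      rw [hq']; field_simp; ring
    have h1 : 2 * (2 * h + 1) * S * (1 - q) * (h + 1) ≤ 2 * (2 * h + 1) * a := by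
      have := mul_le_mul_of_nonneg_left hsum (show (0 : ℝ) ≤ 2 * (2 * h + 1) by positivity)
      linarith
    have h2 := mul_lt_mul_of_pos_right key (mul_pos (mul_pos ha hq0) (show (0:ℝ) < h + 1 by linarith))
    have h3 := mul_le_mul_of_nonneg_right htot (mul_pos hq0 (show (0:ℝ) < h + 1 by linarith)).le
    refine lt_of_mul_lt_mul_right (a := (1 - q) * (h + 1)) ?_ (by positivity)
    calc 2 * (2 * h + 1) * S * ((1 - q) * (h + 1)) ≤ 2 * (2 * h + 1) * a := by linarith
      _ = (2 * h / κ + 2 * h / (h + 1)) * (a * (1 - q) * (h + 1)) := by rw [← e2]; ring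
      _ < _ := h2
      _ = _ := by ring
      _ ≤ _ := h3

/-! ### Random balanced bipartitions -/

open Classical in
theorem card_filter_powersetCard_le {V : Type*} {U N : Finset V} (hN : N ⊆ U) (m d : ℕ) :
    ((U.powersetCard m).filter fun Z => (N ∩ Z).card = d).card ≤
      N.card.choose d * (U.card - N.card).choose (m - d) := by
  rw [← Finset.card_sdiff_of_subset hN, ← Finset.card_powersetCard d N,
    ← Finset.card_powersetCard (m - d) (U \ N), ← Finset.card_product]
  refine Finset.card_le_card_of_injOn (fun Z => (N ∩ Z, Z \ N)) (fun Z hZ => ?_) ?_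
  · simp only [Finset.coe_filter, Finset.mem_powersetCard, Set.mem_ofPred_eq] at hZ
    obtain ⟨⟨hZU, hZm⟩, hZd⟩ := hZ
    simp only [Finset.coe_product, Set.mem_prod, Finset.mem_coe, Finset.mem_powersetCard]
    refine ⟨⟨Finset.inter_subset_left, hZd⟩, Finset.sdiff_subset_sdiff hZU le_rfl, ?_⟩
    have := Finset.card_inter_add_card_sdiff Z N
    rw [Finset.inter_comm] at this
    omega
  · intro Z _ Z' _ h
    simp only [Prod.mk.injEq] at h
    rw [← Finset.sdiff_union_inter Z N, ← Finset.sdiff_union_inter Z' N, h.2,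
      Finset.inter_comm Z, h.1, Finset.inter_comm]

open Classical in
/-- The expected weight of `v`, when the side opposite to `v` is a random `m`-subset `Z` of the
other vertices and the neighbourhood `N` of `v` has `m + κ` elements. -/
theorem sum_powersetCard_lowDegreeWeight_lt {V : Type*} [Fintype V] {m κ : ℕ}
    (hV : Fintype.card V = 2 * m) {N : Finset V} {v : V} (hv : v ∉ N) (hN : N.card = m + κ)
    (hκ : 1 ≤ κ) (hm : m < κ * (κ + 1)) :
    (2 * m) * ∑ Z ∈ (Finset.univ.erase v).powersetCard m, lowDegreeWeight m (N ∩ Z).card <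
      ((2 * m - 1).choose m : ℝ) := by
  have hsub : N ⊆ Finset.univ.erase v := fun u hu =>
    Finset.mem_erase.2 ⟨fun h => hv (h ▸ hu), Finset.mem_univ u⟩
  have hU : (Finset.univ.erase v).card = 2 * m - 1 := by
    rw [Finset.card_erase_of_mem (Finset.mem_univ v), Finset.card_univ, hV]
  have hpos : 0 < Fintype.card V := Fintype.card_pos_iff.2 ⟨v⟩
  have hle := Finset.card_le_card hsub
  refine lt_of_le_of_lt ?_ (sum_lowDegreeWeight_markedCount_lt hκ (by omega) hm)
  gcongr
  rw [← Finset.sum_fiberwise_of_maps_to (g := fun Z => (N ∩ Z).card) (t := Finset.range (m + 1))]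
  · refine Finset.sum_le_sum fun d _ => ?_
    rw [Finset.sum_congr rfl (g := fun _ => lowDegreeWeight m d), Finset.sum_const, nsmul_eq_mul,
      mul_comm]
    · refine mul_le_mul_of_nonneg_left ?_ (lowDegreeWeight_nonneg m d)
      have := card_filter_powersetCard_le hsub m d
      rw [hN, hU, show 2 * m - 1 - (m + κ) = m - 1 - κ by omega] at this
      exact_mod_cast this
    · intro Z hZ
      rw [(Finset.mem_filter.1 hZ).2]
  · intro Z hZ
    have h1 := (Finset.mem_powersetCard.1 hZ).2
    have h2 : (N ∩ Z).card ≤ Z.card := Finset.card_le_card Finset.inter_subset_right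
    exact Finset.mem_range.2 (by omega)

theorem choose_two_mul {m : ℕ} (hm : 0 < m) :
    (2 * m).choose m = 2 * (2 * m - 1).choose m := by
  obtain ⟨k, rfl⟩ := Nat.exists_eq_add_of_le' hm
  rw [show 2 * (k + 0 + 1) - 1 = 2 * k + 1 by omega, show 2 * (k + 0 + 1) = 2 * k + 1 + 1 by omega,
    Nat.choose_succ_succ, ← Nat.choose_symm_half]
  ring

open Classical in
/-- The expected weight of the vertex `v` over all balanced bipartitions `(X, Xᶜ)`, where `v` has
the neighbourhood `N` if it lies in `X` and `N'` otherwise. -/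
theorem sum_balanced_lowDegreeWeight_lt {V : Type*} [Fintype V] {m κ κ' : ℕ}
    (hV : Fintype.card V = 2 * m) {N N' : Finset V} {v : V} (hv : v ∉ N) (hv' : v ∉ N')
    (hN : N.card = m + κ) (hN' : N'.card = m + κ') (hκ : 1 ≤ κ) (hκ' : 1 ≤ κ')
    (hm : m < κ * (κ + 1)) (hm' : m < κ' * (κ' + 1)) :
    (2 * m) * ∑ X ∈ (Finset.univ : Finset V).powersetCard m,
      (if v ∈ X then lowDegreeWeight m (N \ X).card else lowDegreeWeight m (N' ∩ X).card) <
      ((2 * m).choose m : ℝ) := by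
  have hpos : 0 < Fintype.card V := Fintype.card_pos_iff.2 ⟨v⟩
  have h1 := sum_powersetCard_lowDegreeWeight_lt hV hv hN hκ hm
  have h2 := sum_powersetCard_lowDegreeWeight_lt hV hv' hN' hκ' hm'
  rw [choose_two_mul (by omega), Finset.sum_ite]
  have e1 : ∑ X ∈ ((Finset.univ : Finset V).powersetCard m).filter (v ∈ ·),
      lowDegreeWeight m (N \ X).card =
      ∑ Z ∈ (Finset.univ.erase v).powersetCard m, lowDegreeWeight m (N ∩ Z).card := by
    refine Finset.sum_nbij' compl compl ?_ ?_ (fun X _ => compl_compl X)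
      (fun X _ => compl_compl X) (fun X _ => by rw [Finset.sdiff_eq_inter_compl])
    · intro X hX
      simp only [Finset.mem_filter, Finset.mem_powersetCard, Finset.subset_univ, true_and] at hX
      refine Finset.mem_powersetCard.2 ⟨fun u hu => ?_, ?_⟩
      · exact Finset.mem_erase.2 ⟨fun h => Finset.mem_compl.1 hu (h ▸ hX.2), Finset.mem_univ u⟩
      · rw [Finset.card_compl, hX.1, hV]; omega
    · intro Z hZ
      obtain ⟨hZ1, hZ2⟩ := Finset.mem_powersetCard.1 hZ
      simp only [Finset.mem_filter, Finset.mem_powersetCard, Finset.subset_univ, true_and,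
        Finset.mem_compl]
      refine ⟨?_, fun h => (Finset.mem_erase.1 (hZ1 h)).1 rfl⟩
      rw [Finset.card_compl, hZ2, hV]; omega
  have e2 : ((Finset.univ : Finset V).powersetCard m).filter (v ∉ ·) =
      (Finset.univ.erase v).powersetCard m := by
    ext X
    simp only [Finset.mem_filter, Finset.mem_powersetCard, Finset.subset_univ, true_and,
      Finset.subset_erase]
    exact and_comm
  rw [e1, e2, mul_add]
  push_cast
  linarith

open Classical in
/-- If every in- and outdegree is `m + κ` with `m < κ (κ + 1)`, where `κ` may depend on the vertex
and the direction, then some balanced bipartition has total weight less than `1`. -/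
theorem exists_balanced_weight_lt_one {V : Type*} [Fintype V] {m : ℕ}
    (hV : Fintype.card V = 2 * m) (N N' : V → Finset V) (κ κ' : V → ℕ) (hv : ∀ v, v ∉ N v)
    (hv' : ∀ v, v ∉ N' v) (hN : ∀ v, (N v).card = m + κ v) (hN' : ∀ v, (N' v).card = m + κ' v)
    (hκ : ∀ v, 1 ≤ κ v) (hκ' : ∀ v, 1 ≤ κ' v) (hm : ∀ v, m < κ v * (κ v + 1))
    (hm' : ∀ v, m < κ' v * (κ' v + 1)) :
    ∃ X : Finset V, X.card = m ∧ ∑ v, (if v ∈ X then lowDegreeWeight m (N v \ X).card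
      else lowDegreeWeight m (N' v ∩ X).card) < 1 := by
  have hsum : ∑ X ∈ (Finset.univ : Finset V).powersetCard m,
      ∑ v, (if v ∈ X then lowDegreeWeight m (N v \ X).card
        else lowDegreeWeight m (N' v ∩ X).card) <
      ∑ X ∈ (Finset.univ : Finset V).powersetCard m, (1 : ℝ) := by
    rw [Finset.sum_comm, Finset.sum_const, Finset.card_powersetCard, Finset.card_univ, hV,
      nsmul_one]
    rcases isEmpty_or_nonempty V with hE | hE
    · rw [Finset.univ_eq_empty, Finset.sum_empty]
      exact_mod_cast Nat.choose_pos (by omega)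
    · have hpos : 0 < Fintype.card V := Fintype.card_pos
      have hm0 : (0 : ℝ) < 2 * m := by exact_mod_cast hV ▸ hpos
      calc _ < ∑ v : V, ((2 * m).choose m : ℝ) / (2 * m) := by
            refine Finset.sum_lt_sum_of_nonempty Finset.univ_nonempty fun v _ => ?_
            rw [lt_div_iff₀' hm0]
            exact sum_balanced_lowDegreeWeight_lt hV (hv v) (hv' v) (hN v) (hN' v) (hκ v) (hκ' v)
              (hm v) (hm' v)
        _ = (2 * m).choose m := by
            rw [Finset.sum_const, Finset.card_univ, hV, nsmul_eq_mul]
            push_cast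
            exact mul_div_cancel₀ _ hm0.ne'
  obtain ⟨X, hX, hlt⟩ := Finset.exists_lt_of_sum_lt hsum
  exact ⟨X, (Finset.mem_powersetCard.1 hX).2, hlt⟩

/-- The analytic hypothesis, used for a degree `m + κ`, where `2 * m` is the number of vertices. -/
theorem lt_mul_succ_of_log {m κ : ℕ} {p : ℝ} (hm : 0 < m) (hp₁ : 1 / 2 < p) (hp₂ : p < 3 / 4)
    (hκ : p * (2 * m) ≤ m + κ)
    (hn : Real.log 4 / ((p - 1 / 2) * Real.log ((p + 1 / 2) / (3 / 2 - p))) - 1 / (p - 1 / 2)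
      < 2 * m) : m < κ * (κ + 1) := by
  have hε : 0 < p - 1 / 2 := by linarith
  have hden : 0 < 3 / 2 - p := by linarith
  have hm' : (0 : ℝ) < m := by exact_mod_cast hm
  set L := Real.log ((p + 1 / 2) / (3 / 2 - p)) with hLdef
  have hL0 : 0 < L := Real.log_pos ((one_lt_div hden).2 (by linarith))
  have hL : L ≤ 8 / 3 * (p - 1 / 2) := by
    refine (Real.log_le_sub_one_of_pos (by positivity)).trans ?_
    rw [div_sub_one hden.ne', div_le_iff₀ hden]
    nlinarith
  have h4 : 4 / 3 < Real.log 4 := by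
    rw [show (4 : ℝ) = 2 ^ 2 by norm_num, Real.log_pow]
    have := Real.log_two_gt_d9
    push_cast
    linarith
  have h1 : Real.log 4 < (2 * m * (p - 1 / 2) + 1) * L := by
    rw [sub_lt_iff_lt_add, div_lt_iff₀ (by positivity)] at hn
    calc _ < _ := hn
      _ = (2 * m * (p - 1 / 2) + (p - 1 / 2) / (p - 1 / 2)) * L := by ring
      _ = _ := by rw [div_self hε.ne']
  have h2 : 2 * m * (p - 1 / 2) ≤ κ := by linarith
  have h3 : (2 * m * (p - 1 / 2) + 1) * L ≤ (κ + 1) * (8 / 3 * (p - 1 / 2)) := by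
    gcongr
  have h5 : (1 : ℝ) < (κ + 1) * (2 * (p - 1 / 2)) := by linarith
  have h6 : (m : ℝ) < κ * (κ + 1) := by
    calc (m : ℝ) = m * 1 := (mul_one _).symm
      _ < m * ((κ + 1) * (2 * (p - 1 / 2))) := by gcongr
      _ = (2 * m * (p - 1 / 2)) * (κ + 1) := by ring
      _ ≤ κ * (κ + 1) := by gcongr
  exact_mod_cast h6

open Classical in
/-- A bipartition `(X, Xᶜ)` of total weight less than `1`, for the arcs from `X` to `Xᶜ`, gives an
anti-directed 2-factor. -/
theorem hasAntiDirectedTwoFactor_of_weight_lt_one {V : Type*} [Fintype V] (D : Digraph V) {m : ℕ}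
    (hV : Fintype.card V = 2 * m) (X : Finset V) (hX : X.card = m)
    (hw : ∑ v, (if v ∈ X then lowDegreeWeight m (Finset.univ.filter (D.Adj v) \ X).card
      else lowDegreeWeight m (Finset.univ.filter (D.Adj · v) ∩ X).card) < 1) :
    D.HasAntiDirectedTwoFactor := by
  rw [← Fintype.sum_subtype_add_sum_subtype (· ∈ X)] at hw
  have hα : Fintype.card {x // x ∈ X} = m := by simpa using hX
  have hβ : Fintype.card {y // ¬ y ∈ X} = m := by
    rw [Fintype.card_subtype_compl, hV, hα]; omega
  obtain ⟨f, g, hf, hg, hfg⟩ := exists_disjoint_matchings hα hβ (fun a b => D.Adj a b) (by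
    refine lt_of_le_of_lt (le_of_eq ?_) hw
    congr 1
    · refine Finset.sum_congr (by ext; simp) fun a _ => ?_
      rw [if_pos a.2]
      congr 1
      refine Finset.card_nbij Subtype.val (fun b hb => ?_) Subtype.val_injective.injOn
        (fun b hb => ?_)
      · simpa [b.2] using hb
      · simp only [Finset.coe_sdiff, Finset.coe_filter, Finset.mem_univ, true_and, Set.mem_sdiff,
          Set.mem_ofPred_eq, Finset.mem_coe] at hb
        exact ⟨⟨b, hb.2⟩, by simpa using hb.1, rfl⟩
    · refine Finset.sum_congr (by ext; simp) fun b _ => ?_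
      rw [if_neg b.2]
      congr 1
      refine Finset.card_nbij Subtype.val (fun a ha => ?_) Subtype.val_injective.injOn
        (fun a ha => ?_)
      · simpa [a.2] using ha
      · simp only [Finset.coe_inter, Finset.coe_filter, Finset.mem_univ, true_and, Set.mem_inter_iff,
          Set.mem_ofPred_eq, Finset.mem_coe] at ha
        exact ⟨⟨a, ha.2⟩, by simpa using ha.1, rfl⟩)
  exact hasAntiDirectedTwoFactor_of_matchings f g hf hg hfg

end Digraph

theorem theorem7 {V : Type*} [Fintype V] (D : Digraph V)
    (hloop : ∀ v : V, ¬ D.Adj v v)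
    (heven : Even (Fintype.card V))
    (p : ℝ) (hp₁ : 1 / 2 < p) (hp₂ : p < 3 / 4)
    (hout : ∀ v : V, p * (Fintype.card V : ℝ) ≤ (D.outDegree v : ℝ))
    (hin : ∀ v : V, p * (Fintype.card V : ℝ) ≤ (D.inDegree v : ℝ))
    (hn : Real.log 4 / ((p - 1 / 2) * Real.log ((p + 1 / 2) / (3 / 2 - p))) - 1 / (p - 1 / 2)
      < (Fintype.card V : ℝ)) :
    D.HasAntiDirectedTwoFactor := by
  classical
  obtain ⟨m, hm⟩ := heven
  have hV : Fintype.card V = 2 * m := by omega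
  have hVr : (Fintype.card V : ℝ) = 2 * m := by exact_mod_cast hV
  rw [hVr] at hn
  -- a degree is of the form `m + κ` with `κ` large
  have key (v : V) (d : ℕ) (hd : p * (Fintype.card V : ℝ) ≤ d) :
      d = m + (d - m) ∧ 1 ≤ d - m ∧ m < (d - m) * (d - m + 1) := by
    have hm0 : 0 < m := by
      have : 0 < Fintype.card V := Fintype.card_pos_iff.2 ⟨v⟩
      omega
    have hm0' : (0 : ℝ) < m := by exact_mod_cast hm0
    rw [hVr] at hd
    have hlt : m < d := by
      have : (m : ℝ) < d := by nlinarith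
      exact_mod_cast this
    refine ⟨by omega, by omega, Digraph.lt_mul_succ_of_log hm0 hp₁ hp₂ ?_ hn⟩
    rw [Nat.cast_sub hlt.le]
    linarith
  have hcard (P : V → Prop) : {w | P w}.ncard = (Finset.univ.filter P).card := by
    rw [Set.ncard_eq_toFinset_card', Set.toFinset_ofPred]
  have hout' (v : V) := key v (Finset.univ.filter (D.Adj v)).card (by
    rw [← hcard]; exact hout v)
  have hin' (v : V) := key v (Finset.univ.filter (D.Adj · v)).card (by
    rw [← hcard]; exact hin v)
  obtain ⟨X, hX, hw⟩ := Digraph.exists_balanced_weight_lt_one hV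
    (fun v => Finset.univ.filter (D.Adj v)) (fun v => Finset.univ.filter (D.Adj · v)) _ _
    (fun v => by simp [hloop]) (fun v => by simp [hloop]) (fun v => (hout' v).1)
    (fun v => (hin' v).1) (fun v => (hout' v).2.1) (fun v => (hin' v).2.1)
    (fun v => (hout' v).2.2) (fun v => (hin' v).2.2)
  exact D.hasAntiDirectedTwoFactor_of_weight_lt_one hV X hX (by convert hw)
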